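/- Let $m_0,m\ge 1$ and consider a continuous-time level-dependent quasi-birth-and-death (QBD) process with states $(k,i)$, where $k\ge 0$ is the level and the phase $i$ takes $m_0$ values if $k=0$ and $m$ values if $k\ge1$, whose (conservative) infinitesimal generator is the block tridiagonal matrix $$Q=\begin{pmatrix}A_1^{(0)}&A_0^{(0)}&&&\\ A_2^{(1)}&A_1^{(1)}&A_0^{(1)}&&\\ &A_2^{(2)}&A_1^{(2)}&A_0^{(2)}&\\ &&\ddots&\ddots&\ddots\end{pmatrix},$$ the size of $A_1^{(0)}$ being $m_0$ and the size of $A_1^{(k)}$ being $m$ for $k\ge 1$. Suppose that the process is irreducible and positive recurrent. Then: (i) There is a unique stationary probability vector $x=(x_0,x_1,x_2,\dots)$, that is, $x\ge 0$, $\sum_k x_ke=1$ and $xQ=0$, where $e$ denotes a column vector of ones. (ii) The system $A_0^{(l)}+R_lA_1^{(l+1)}+R_lR_{l+1}A_2^{(l+2)}=0$, $l\ge 0$, has a unique minimal nonnegative solution $\{R_l,\ l\ge0\}$, that is, a nonnegative solution which is entrywise at most every other nonnegative solution. (iii) The matrix $U_0=A_1^{(0)}+R_0A_2^{(1)}$ is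 the generator of the chain censored to level $0$ (the process observed only while it is in level $0$), and it has a unique stationary probability vector $v$ (that is, $v\ge0$, $ve=1$, $vU_0=0$). (iv) For every $k\ge0$ the series $\sum_{l\ge0}R_kR_{k+1}\cdots R_{k+l}$ converges, and, with $$\kappa=\frac{1}{1+v\left(\sum_{k=0}^\infty R_0R_1\cdots R_k\right)e},$$ one has $x_0=\kappa v$ and $x_k=\kappa vR_0R_1\cdots R_{k-1}$ for $k\ge1$. Consequently the tail vectors $\pi_k=\sum_{j=k}^\infty x_j$ are $$\pi_k=\kappa vR_0R_1\cdots R_{k-1}\Bigl(I+\sum_{l=0}^\infty R_kR_{k+1}\cdots R_{k+l}\Bigr),\qquad k\ge1 .$$ -/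

import Mathlib

open scoped ENNReal Matrix

noncomputable section

/-! ### Continuous-time Markov chains on a discrete state space, through the generator -/

section MarkovChain

variable {S : Type*}

/-- `Q` is a (stable, conservative) infinitesimal generator: the off-diagonal entries are
nonnegative and every row sums to zero. -/
def IsGenerator (Q : Matrix S S ℝ) : Prop :=
  (∀ i j, i ≠ j → 0 ≤ Q i j) ∧ ∀ i, HasSum (fun j => Q i j) 0

/-- Every state can be reached from every state by transitions of positive rate. -/
def IsIrreducibleGenerator (Q : Matrix S S ℝ) : Prop :=
  ∀ i j, Relation.ReflTransGen (fun a b => a ≠ b ∧ 0 < Q a b) i j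

open Classical in
/-- Transition probabilities of the embedded jump chain `Y` of the generator `Q`. -/
def jumpProb (Q : Matrix S S ℝ) (i j : S) : ℝ≥0∞ :=
  if Q i i = 0 then (if i = j then 1 else 0)
  else (if i = j then 0 else ENNReal.ofReal (Q i j / (-Q i i)))

open Classical in
/-- Taboo probabilities of the chain `Y` with transition probabilities `P`:
`tabooProb P H n i j = ℙ_i (Y_n = j and Y_1, …, Y_n ∉ H)`. -/
def tabooProb (P : S → S → ℝ≥0∞) (H : Set S) : ℕ → S → S → ℝ≥0∞
  | 0, i, j => if i = j then 1 else 0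
  | n + 1, i, j => if j ∈ H then 0 else ∑' k, tabooProb P H n i k * P k j

/-- For `j ∈ H`: the probability, starting at `i`, that `Y` visits `H` at some time `n ≥ 1` and
that its first such visit is at the state `j`. -/
def entranceProb (P : S → S → ℝ≥0∞) (H : Set S) (i j : S) : ℝ≥0∞ :=
  ∑' n, ∑' k, tabooProb P H n i k * P k j

/-- The probability that the chain with generator `Q`, started at `i`, returns to `i`. -/
def returnProb (Q : Matrix S S ℝ) (i : S) : ℝ≥0∞ :=
  entranceProb (jumpProb Q) {i} i i

/-- The mean time that the chain with generator `Q`, started at `i`, spends before the jump by which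
it first returns to `i`: a visit to `j` lasts for an exponential time of mean `1 / (-Q j j)`, so
this is `∑_n ∑_j ℙ_i (Y_n = j, no return up to step n) / (-Q j j)`. It is the mean return
time to `i` when the return is almost sure. -/
def meanReturnTime (Q : Matrix S S ℝ) (i : S) : ℝ≥0∞ :=
  ∑' n, ∑' j, tabooProb (jumpProb Q) {i} n i j * (ENNReal.ofReal (-Q j j))⁻¹

/-- Positive recurrence: every state is absorbing, or is returned to almost surely and in finite
mean time. -/
def IsPositiveRecurrent (Q : Matrix S S ℝ) : Prop :=
  ∀ i, Q i i = 0 ∨ (returnProb Q i = 1 ∧ meanReturnTime Q i < ∞)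

/-- `x` is a stationary probability vector of `Q`: `x ≥ 0`, `x e = 1` and `x Q = 0`. -/
def IsStationaryVector (Q : Matrix S S ℝ) (x : S → ℝ) : Prop :=
  (∀ i, 0 ≤ x i) ∧ HasSum x 1 ∧ ∀ j, HasSum (fun i => x i * Q i j) 0

open Classical in
/-- For `i, j ∈ E`: the `(i, j)` entry of the generator of the chain censored to `E` (the chain
observed only while it is in `E`): the direct rate, plus the rate of leaving `E` from `i`
by an excursion that ends with a return to `E` at `j`. -/
def censoredGenerator (Q : Matrix S S ℝ) (E : Set S) (i j : S) : ℝ :=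
  Q i j + (∑' a, if a ∈ E then 0
    else ENNReal.ofReal (Q i a) * entranceProb (jumpProb Q) E a j).toReal

end MarkovChain

/-! ### Level-dependent QBD processes -/

/-- The number of phases of a level: `m₀` in level `0`, and `m` in the levels `k ≥ 1`. -/
@[reducible] def levelSize (m₀ m : ℕ) : ℕ → ℕ
  | 0 => m₀
  | _ + 1 => m

/-- The states: pairs of a level and a phase. -/
abbrev QBDState (m₀ m : ℕ) : Type := Σ k : ℕ, Fin (levelSize m₀ m k)

/-- The blocks of the block tridiagonal matrix of a level-dependent QBD process. Here `A0 k` is the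
block `A_0^{(k)}`, `A1 k` is `A_1^{(k)}`, while `A2 k` is `A_2^{(k+1)}` (there is no
`A_2^{(0)}`). -/
structure LevelDependentQBD (m₀ m : ℕ) where
  /-- `A0 k = A_0^{(k)}`: from level `k` to level `k + 1`. -/
  A0 : ∀ k, Matrix (Fin (levelSize m₀ m k)) (Fin (levelSize m₀ m (k + 1))) ℝ
  /-- `A1 k = A_1^{(k)}`: within level `k`. -/
  A1 : ∀ k, Matrix (Fin (levelSize m₀ m k)) (Fin (levelSize m₀ m k)) ℝ
  /-- `A2 k = A_2^{(k+1)}`: from level `k + 1` to level `k`. -/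
  A2 : ∀ k, Matrix (Fin (levelSize m₀ m (k + 1))) (Fin (levelSize m₀ m k)) ℝ

/-- A sequence of matrices `R l`, `l ≥ 0`, of the shapes of the blocks `A_0^{(l)}`. -/
abbrev RSequence (m₀ m : ℕ) : Type :=
  ∀ l : ℕ, Matrix (Fin (levelSize m₀ m l)) (Fin (levelSize m₀ m (l + 1))) ℝ

/-- `rProd R k l = R_k R_{k+1} ⋯ R_{k+l}`. -/
def rProd {m₀ m : ℕ} (R : RSequence m₀ m) (k : ℕ) :
    ℕ → Matrix (Fin (levelSize m₀ m k)) (Fin m) ℝ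
  | 0 => R k
  | l + 1 => rProd R k l * (R (k + l + 1) : Matrix (Fin m) (Fin m) ℝ)

/-- `rSeries R k = ∑_{l ≥ 0} R_k R_{k+1} ⋯ R_{k+l}`. -/
def rSeries {m₀ m : ℕ} (R : RSequence m₀ m) (k : ℕ) :
    Matrix (Fin (levelSize m₀ m k)) (Fin m) ℝ :=
  ∑' l, rProd R k l

/-- `κ = 1 / (1 + v (∑_{k ≥ 0} R_0 R_1 ⋯ R_k) e)`. -/
def kappa {m₀ m : ℕ} (R : RSequence m₀ m) (v : Fin (levelSize m₀ m 0) → ℝ) : ℝ :=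
  1 / (1 + ∑ j, (v ᵥ* rSeries R 0) j)

namespace LevelDependentQBD

variable {m₀ m : ℕ} (A : LevelDependentQBD m₀ m)

/-- The block tridiagonal matrix `Q` with the given blocks. -/
def Q : Matrix (QBDState m₀ m) (QBDState m₀ m) ℝ := fun s t =>
  if h : t.1 = s.1 then A.A1 s.1 s.2 (Fin.cast (by rw [h]) t.2)
  else if h : t.1 = s.1 + 1 then A.A0 s.1 s.2 (Fin.cast (by rw [h]) t.2)
  else if h : s.1 = t.1 + 1 then A.A2 t.1 (Fin.cast (by rw [h]) s.2) t.2
  else 0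

/-- `R` is a nonnegative solution of
`A_0^{(l)} + R_l A_1^{(l+1)} + R_l R_{l+1} A_2^{(l+2)} = 0`, `l ≥ 0`. -/
def IsNonnegSolution (R : RSequence m₀ m) : Prop :=
  (∀ l i j, 0 ≤ R l i j) ∧
    ∀ l, A.A0 l + R l * A.A1 (l + 1) + R l * R (l + 1) * A.A2 (l + 1) = 0

/-- `R` is the minimal nonnegative solution: it is entrywise below every nonnegative solution. -/
def IsMinimalNonnegSolution (R : RSequence m₀ m) : Prop :=
  A.IsNonnegSolution R ∧ ∀ R', A.IsNonnegSolution R' → ∀ l i j, R l i j ≤ R' l i j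

/-- `U_0 = A_1^{(0)} + R_0 A_2^{(1)}`. -/
def U0 (R : RSequence m₀ m) :
    Matrix (Fin (levelSize m₀ m 0)) (Fin (levelSize m₀ m 0)) ℝ :=
  A.A1 0 + R 0 * A.A2 0

end LevelDependentQBD

end

/-! For nonnegative `x`, the equation `xQ = 0` is a flow balance at every state: inflow equals `x s`
times the exit rate. Both sides are sums of nonnegative terms, so the argument runs in `ℝ≥0∞`, where
sums may be exchanged freely. The basic tool is `tabooPotential_le`: expected visits before entering
a set are the least solution of their one-step equation.

For a recurrent irreducible chain, a superinvariant measure dominates a multiple of `cycleMeasure`.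
The difference is superinvariant and vanishes at one state, hence everywhere
(`eq_mul_cycleMeasure`). This gives existence and uniqueness of the stationary vector.

`R_l` is taken to be the expected time in level `l + 1` before returning to levels `≤ l`, per unit
of time in level `l`. Splitting by the last visit to a set (`tsum_mul_sojournTime_eq`) gives
`x_{l+1} = x_l R_l`. Splitting along nested sets (`tsum_sojournTime_mul_sojournTime`) identifies
`R_l R_{l+1}` with the time in level `l + 2`, and balance at level `l + 1` is then the matrix
equation. Least potentials make this solution minimal. Conversely, a stationary `v` of `U_0` extends
to the invariant vector `v, v R_0, v R_0 R_1, …`, a multiple of `x`, and its total mass yields `κ`.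
-/

noncomputable section

/-! ### Potentials of a chain killed on entering a set. -/

section TabooPotential

variable {S : Type*}

/-- The expected number of visits to `j`, starting at `i`, before the set `H` is entered. -/
def tabooGreen (P : S → S → ℝ≥0∞) (H : Set S) (i j : S) : ℝ≥0∞ :=
  ∑' n, tabooProb P H n i j

/-- The expected numbers of visits before entering `H`, for the initial measure `b`. -/
def tabooPotential (P : S → S → ℝ≥0∞) (H : Set S) (b : S → ℝ≥0∞) (j : S) : ℝ≥0∞ :=
  ∑' i, b i * tabooGreen P H i j

open Classical in
theorem tabooPotential_step (P : S → S → ℝ≥0∞) (H : Set S) (b : S → ℝ≥0∞) (n : ℕ) (j : S) :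
    ∑' i, b i * tabooProb P H (n + 1) i j =
      if j ∈ H then 0 else ∑' k, (∑' i, b i * tabooProb P H n i k) * P k j := by
  by_cases hj : j ∈ H
  · simp [tabooProb, hj]
  · simp only [tabooProb, hj, if_false, ← ENNReal.tsum_mul_left, ← ENNReal.tsum_mul_right]
    rw [ENNReal.tsum_comm]
    simp only [mul_assoc]

theorem tabooPotential_eq_tsum (P : S → S → ℝ≥0∞) (H : Set S) (b : S → ℝ≥0∞) (j : S) :
    tabooPotential P H b j = ∑' n, ∑' i, b i * tabooProb P H n i j := by
  simp only [tabooPotential, tabooGreen, ← ENNReal.tsum_mul_left]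
  rw [ENNReal.tsum_comm]

theorem tsum_mul_tabooProb_zero (P : S → S → ℝ≥0∞) (H : Set S) (b : S → ℝ≥0∞) (j : S) :
    ∑' i, b i * tabooProb P H 0 i j = b j := by
  rw [tsum_eq_single j (fun i hi => by simp [tabooProb, hi])]
  simp [tabooProb]

open Classical in
theorem tabooPotential_eq (P : S → S → ℝ≥0∞) (H : Set S) (b : S → ℝ≥0∞) (j : S) :
    tabooPotential P H b j =
      b j + if j ∈ H then 0 else ∑' k, tabooPotential P H b k * P k j := by
  rw [tabooPotential_eq_tsum, tsum_eq_zero_add' ENNReal.summable, tsum_mul_tabooProb_zero]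
  congr 1
  simp only [tabooPotential_step]
  by_cases hj : j ∈ H
  · simp [hj]
  · simp only [hj, if_false]
    rw [ENNReal.tsum_comm]
    simp only [ENNReal.tsum_mul_right, ← tabooPotential_eq_tsum]

open Classical in
-- Minimality principle: the partial sums over time are the iterates, from zero, of the monotone map
-- in the hypothesis, so they stay below any `u` that the map does not increase.
theorem tabooPotential_le {P : S → S → ℝ≥0∞} {H : Set S} {b u : S → ℝ≥0∞}
    (hu : ∀ j, b j + (if j ∈ H then 0 else ∑' k, u k * P k j) ≤ u j) (j : S) :
    tabooPotential P H b j ≤ u j := by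
  rw [tabooPotential_eq_tsum, ENNReal.tsum_eq_iSup_nat]
  refine iSup_le fun N => ?_
  induction N generalizing j with
  | zero => simp
  | succ N ih =>
    rw [Finset.sum_range_succ', tsum_mul_tabooProb_zero, add_comm]
    refine le_trans ?_ (hu j)
    gcongr
    simp only [tabooPotential_step]
    by_cases hj : j ∈ H
    · simp [hj]
    · simp only [hj, if_false]
      rw [← Summable.tsum_finsetSum (fun _ _ => ENNReal.summable)]
      simp only [← Finset.sum_mul]
      gcongr with k
      exact ih k

theorem tabooPotential_add (P : S → S → ℝ≥0∞) (H : Set S) (x : S → ℝ≥0∞) (b : S → S → ℝ≥0∞)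
    (j : S) : tabooPotential P H (fun a => ∑' i, x i * b i a) j =
      ∑' i, x i * tabooPotential P H (b i) j := by
  simp only [tabooPotential, ← ENNReal.tsum_mul_left, ← ENNReal.tsum_mul_right, mul_assoc]
  rw [ENNReal.tsum_comm]

theorem tabooPotential_single (P : S → S → ℝ≥0∞) (H : Set S) [DecidableEq S] (i j : S) :
    tabooPotential P H (fun a => if i = a then 1 else 0) j = tabooGreen P H i j := by
  rw [tabooPotential, tsum_eq_single i (fun a ha => by simp [ha.symm])]
  simp

theorem entranceProb_eq_tsum (P : S → S → ℝ≥0∞) (H : Set S) (i j : S) :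
    entranceProb P H i j = ∑' k, tabooGreen P H i k * P k j := by
  rw [entranceProb, ENNReal.tsum_comm]
  simp only [ENNReal.tsum_mul_right, tabooGreen]

end TabooPotential

/-! ### Flow balance and uniqueness of invariant measures. -/

section Balance

variable {S : Type*} {Q : Matrix S S ℝ}

open Classical in
/-- The rate of the jumps from `i` to `j`. -/
def jumpRate (Q : Matrix S S ℝ) (i j : S) : ℝ≥0∞ :=
  if i = j then 0 else ENNReal.ofReal (Q i j)

/-- The total rate of the jumps out of `j`. -/
def exitRate (Q : Matrix S S ℝ) (j : S) : ℝ≥0∞ := ENNReal.ofReal (-Q j j)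

theorem exitRate_ne_zero (hq : ∀ i, Q i i < 0) (i : S) : exitRate Q i ≠ 0 := by
  simpa [exitRate] using hq i

theorem exitRate_ne_top (Q : Matrix S S ℝ) (i : S) : exitRate Q i ≠ ∞ := ENNReal.ofReal_ne_top

theorem exitRate_mul_jumpProb (hq : ∀ i, Q i i < 0) (i j : S) :
    exitRate Q i * jumpProb Q i j = jumpRate Q i j := by
  by_cases h : i = j
  · simp [jumpProb, jumpRate, h, (hq j).ne]
  · have h0 : 0 < -Q i i := by linarith [hq i]
    simp only [jumpProb, jumpRate, h, (hq i).ne, if_false]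
    rw [ENNReal.ofReal_div_of_pos h0]
    exact ENNReal.mul_div_cancel (exitRate_ne_zero hq i) (exitRate_ne_top Q i)

theorem div_exitRate_mul_jumpRate (hq : ∀ i, Q i i < 0) (c : ℝ≥0∞) (i j : S) :
    c / exitRate Q i * jumpRate Q i j = c * jumpProb Q i j := by
  rw [← exitRate_mul_jumpProb hq, ← mul_assoc, ENNReal.div_mul_cancel
    (exitRate_ne_zero hq i) (exitRate_ne_top Q i)]

open Classical in
theorem hasSum_zero_iff_hasSum_offDiag (f : S → ℝ) (j : S) :
    HasSum f 0 ↔ HasSum (fun i => if i = j then 0 else f i) (-f j) := by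
  have h1 : HasSum (fun i => if i = j then f j else 0) (f j) := hasSum_ite_eq j (f j)
  constructor
  · intro h
    have h2 := h.sub h1
    rw [zero_sub] at h2
    refine h2.congr_fun fun i => ?_
    by_cases hi : i = j <;> simp [hi]
  · intro h
    have h2 := h.add h1
    rw [neg_add_cancel] at h2
    refine h2.congr_fun fun i => ?_
    by_cases hi : i = j <;> simp [hi]

/-- Moving the diagonal term across leaves nonnegative terms on both sides. In the converse
direction, summability comes from the finiteness of the right side. -/
theorem hasSum_mul_generator_iff (hgen : IsGenerator Q) {x : S → ℝ} (hx : ∀ i, 0 ≤ x i) (j : S) :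
    HasSum (fun i => x i * Q i j) 0 ↔
      ∑' i, ENNReal.ofReal (x i) * jumpRate Q i j = ENNReal.ofReal (x j) * exitRate Q j := by
  classical
  have hnn : ∀ i, 0 ≤ if i = j then 0 else x i * Q i j := fun i => by
    split_ifs with h
    · exact le_rfl
    · exact mul_nonneg (hx i) (hgen.1 i j h)
  have hqq : 0 ≤ -Q j j :=
    ((hasSum_zero_iff_hasSum_offDiag _ j).1 (hgen.2 j)).nonneg fun i => by
      split_ifs with h
      · exact le_rfl
      · exact hgen.1 j i (Ne.symm h)
  have h2 : ∀ i, ENNReal.ofReal (x i) * jumpRate Q i j =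
      ENNReal.ofReal (if i = j then 0 else x i * Q i j) := fun i => by
    by_cases h : i = j
    · simp [jumpRate, h]
    · simp [jumpRate, h, ENNReal.ofReal_mul (hx i)]
  rw [hasSum_zero_iff_hasSum_offDiag _ j, ← mul_neg]
  simp only [h2, exitRate]
  rw [← ENNReal.ofReal_mul (hx j)]
  constructor
  · intro h
    rw [← h.tsum_eq, ENNReal.ofReal_tsum_of_nonneg hnn h.summable]
  · intro h
    have hs : Summable (fun i => if i = j then 0 else x i * Q i j) := by
      have := ENNReal.summable_toReal (h ▸ ENNReal.ofReal_ne_top)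
      simpa only [ENNReal.toReal_ofReal (hnn _)] using this
    rw [← ENNReal.ofReal_tsum_of_nonneg hnn hs, ENNReal.ofReal_eq_ofReal_iff (tsum_nonneg hnn)
      (mul_nonneg (hx j) hqq)] at h
    exact h ▸ hs.hasSum

/-- A state of mass zero has no inflow, so every state that jumps to it has mass zero too; follow a
path to `o` backwards. -/
theorem eq_zero_of_superbalanced (hirr : IsIrreducibleGenerator Q)
    {z : S → ℝ≥0∞} (hz : ∀ s, ∑' t, z t * jumpRate Q t s ≤ z s * exitRate Q s) {o : S}
    (ho : z o = 0) (s : S) : z s = 0 := by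
  refine Relation.ReflTransGen.head_induction_on (hirr s o) ho ?_
  intro a b hab _ hb
  have h1 : z a * jumpRate Q a b ≤ 0 := by
    have := (ENNReal.le_tsum (f := fun t => z t * jumpRate Q t b) a).trans (hz b)
    simpa [hb] using this
  have h2 : jumpRate Q a b ≠ 0 := by simpa [jumpRate, hab.1] using hab.2
  simpa [h2] using h1

theorem diag_neg_of_irreducible [Nontrivial S] (hgen : IsGenerator Q)
    (hirr : IsIrreducibleGenerator Q) (i : S) : Q i i < 0 := by
  classical
  obtain ⟨j, hj⟩ := exists_ne i
  obtain h | ⟨c, hc, -⟩ := (hirr i j).cases_head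
  · exact absurd h.symm hj
  · have h1 := (hasSum_zero_iff_hasSum_offDiag _ i).1 (hgen.2 i)
    have h2 := le_hasSum h1 c fun k _ => by
      split_ifs with h
      · exact le_rfl
      · exact hgen.1 i k (Ne.symm h)
    rw [if_neg hc.1.symm] at h2
    linarith [hc.2]

/-- The expected time spent in `j` between two visits to `o`. -/
def cycleMeasure (Q : Matrix S S ℝ) (o j : S) : ℝ≥0∞ :=
  tabooGreen (jumpProb Q) {o} o j / exitRate Q j

theorem tsum_cycleMeasure (o : S) : ∑' j, cycleMeasure Q o j = meanReturnTime Q o := by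
  rw [meanReturnTime, ENNReal.tsum_comm]
  simp only [ENNReal.tsum_mul_right, cycleMeasure, tabooGreen, div_eq_mul_inv, exitRate]

theorem tabooGreen_self (P : S → S → ℝ≥0∞) (o : S) : tabooGreen P {o} o o = 1 := by
  classical
  rw [← tabooPotential_single, tabooPotential_eq]
  simp

/-- Away from `o` this is the one-step equation of the potential. At `o` the inflow is the return
probability, and recurrence makes it match the outflow `1`. -/
theorem cycleMeasure_balanced (hq : ∀ i, Q i i < 0) {o : S} (hret : returnProb Q o = 1) (s : S) :
    ∑' t, cycleMeasure Q o t * jumpRate Q t s = cycleMeasure Q o s * exitRate Q s := by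
  classical
  simp only [cycleMeasure, div_exitRate_mul_jumpRate hq]
  rw [ENNReal.div_mul_cancel (exitRate_ne_zero hq s) (exitRate_ne_top Q s)]
  by_cases hs : s = o
  · subst hs
    rw [← entranceProb_eq_tsum, tabooGreen_self]
    exact hret
  · conv_rhs => rw [← tabooPotential_single, tabooPotential_eq]
    simp [hs, Ne.symm hs, tabooPotential_single]

theorem cycleMeasure_self_ne_zero (o : S) : cycleMeasure Q o o ≠ 0 := by
  simp [cycleMeasure, tabooGreen_self, exitRate_ne_top]

/-- Superinvariant measures of a recurrent irreducible chain are multiples of `cycleMeasure`. -/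
theorem eq_mul_cycleMeasure (hirr : IsIrreducibleGenerator Q) (hq : ∀ i, Q i i < 0)
    {o : S} (hret : returnProb Q o = 1) (hmean : meanReturnTime Q o < ∞)
    {x : S → ℝ≥0∞} (hx : ∀ s, ∑' t, x t * jumpRate Q t s ≤ x s * exitRate Q s) (hxo : x o ≠ ∞)
    (s : S) : x s = x o * exitRate Q o * cycleMeasure Q o s := by
  classical
  have hle : ∀ s, x o * exitRate Q o * cycleMeasure Q o s ≤ x s := by
    intro s
    have h := tabooPotential_le (P := jumpProb Q) (H := {o})
      (b := fun a => ∑' i, (if i = o then x o * exitRate Q o else 0) * (if i = a then 1 else 0))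
      (u := fun s => x s * exitRate Q s) (fun j => ?_) s
    · rw [tabooPotential_add, tsum_eq_single o (fun i hi => by simp [hi])] at h
      simp only [if_true, tabooPotential_single] at h
      rw [cycleMeasure, ← mul_div_assoc]
      exact ENNReal.div_le_of_le_mul h
    · rw [tsum_eq_single j (fun i hi => by simp [hi])]
      by_cases hj : j = o
      · simp [hj]
      · simpa [hj, mul_assoc, exitRate_mul_jumpProb hq] using hx j
  -- The finite mean return time makes the lower bound finite, so that it can be cancelled from the
  -- balance inequality for `x`.
  have hfin : ∀ s, x o * exitRate Q o * cycleMeasure Q o s ≠ ∞ := by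
    intro s
    refine ENNReal.mul_ne_top (ENNReal.mul_ne_top hxo (exitRate_ne_top Q o)) ?_
    exact ((ENNReal.le_tsum s).trans_lt ((tsum_cycleMeasure (Q := Q) o).trans_lt hmean)).ne
  set w : S → ℝ≥0∞ := fun s => x o * exitRate Q o * cycleMeasure Q o s with hw
  have hwbal : ∀ s, ∑' t, w t * jumpRate Q t s = w s * exitRate Q s := by
    intro s
    simp only [hw, mul_assoc, ENNReal.tsum_mul_left]
    rw [cycleMeasure_balanced hq hret]
  have hz := eq_zero_of_superbalanced hirr (z := fun s => x s - w s) (o := o) ?_ ?_ s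
  · exact le_antisymm (tsub_eq_zero_iff_le.1 hz) (hle s)
  · intro s
    have h1 : ∀ t, x t = (x t - w t) + w t := fun t => (tsub_add_cancel_of_le (hle t)).symm
    have h2 := hx s
    rw [h1 s, add_mul, ← hwbal s] at h2
    have h3 : ∑' t, x t * jumpRate Q t s =
        ∑' t, (x t - w t) * jumpRate Q t s + ∑' t, w t * jumpRate Q t s := by
      rw [← ENNReal.tsum_add]
      refine tsum_congr fun t => ?_
      rw [← add_mul, ← h1]
    rw [h3] at h2
    refine (ENNReal.add_le_add_iff_right ?_).1 h2
    rw [hwbal]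
    exact ENNReal.mul_ne_top (hfin s) (exitRate_ne_top Q s)
  · have : w o = x o := by
      simp only [hw, cycleMeasure, tabooGreen_self, mul_assoc]
      rw [ENNReal.mul_div_cancel (exitRate_ne_zero hq o) (exitRate_ne_top Q o), mul_one]
    simp [this]

end Balance

/-! ### Time spent outside a set between visits to it. -/

section Sojourn

variable {S : Type*} {Q : Matrix S S ℝ}

open Classical in
/-- The rate of the jumps from `i` to `a` if `a` is outside `H`, and `0` otherwise. -/
def escapeRate (Q : Matrix S S ℝ) (H : Set S) (i a : S) : ℝ≥0∞ :=
  if a ∈ H then 0 else jumpRate Q i a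

open Classical in
/-- For `i ∈ H` and `s ∉ H`: the expected time spent in `s` before returning to `H`, per unit of
time spent in `i`. For `s ∈ H` this is the identity matrix. -/
def sojournTime (Q : Matrix S S ℝ) (H : Set S) (i s : S) : ℝ≥0∞ :=
  if s ∈ H then (if i = s then 1 else 0)
  else tabooPotential (jumpProb Q) H (escapeRate Q H i) s / exitRate Q s

theorem tabooPotential_escapeRate_of_mem {H : Set S} {s : S} (hs : s ∈ H) (P : S → S → ℝ≥0∞)
    (i : S) : tabooPotential P H (escapeRate Q H i) s = 0 := by
  rw [tabooPotential_eq]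
  simp [hs, escapeRate]

open Classical in
-- Inside `H` only `i` carries mass, and its flow into `s` is the source term of the potential
-- equation.
theorem tsum_sojournTime_mul_jumpRate (hq : ∀ i, Q i i < 0) {H : Set S} {i s : S} (hi : i ∈ H)
    (hs : s ∉ H) :
    ∑' t, sojournTime Q H i t * jumpRate Q t s = sojournTime Q H i s * exitRate Q s := by
  have h1 : ∀ t, sojournTime Q H i t * jumpRate Q t s = (if t = i then jumpRate Q i s else 0) +
      tabooPotential (jumpProb Q) H (escapeRate Q H i) t * jumpProb Q t s := by
    intro t
    by_cases ht : t ∈ H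
    · rw [tabooPotential_escapeRate_of_mem ht]
      by_cases hit : t = i
      · subst hit; simp [sojournTime, ht]
      · simp [sojournTime, ht, hit, Ne.symm hit]
    · have hti : t ≠ i := fun h => ht (h ▸ hi)
      simp [sojournTime, ht, hti, div_exitRate_mul_jumpRate hq]
  simp only [h1, ENNReal.tsum_add, tsum_ite_eq]
  rw [sojournTime, if_neg hs, ENNReal.div_mul_cancel (exitRate_ne_zero hq s) (exitRate_ne_top Q s),
    tabooPotential_eq (j := s)]
  simp [hs, escapeRate]

open Classical in
theorem tsum_mul_sojournTime_of_mem {H : Set S} {s : S} (hs : s ∈ H) (y : S → ℝ≥0∞) :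
    ∑' i, (if i ∈ H then y i else 0) * sojournTime Q H i s = y s := by
  rw [tsum_eq_single s (fun i hi => by simp [sojournTime, hs, hi])]
  simp [sojournTime, hs]

open Classical in
theorem tsum_mul_sojournTime_le (hq : ∀ i, Q i i < 0) {H : Set S} {y : S → ℝ≥0∞}
    (hy : ∀ s ∉ H, ∑' t, y t * jumpRate Q t s ≤ y s * exitRate Q s) (s : S) :
    ∑' i, (if i ∈ H then y i else 0) * sojournTime Q H i s ≤ y s := by
  by_cases hs : s ∈ H
  · exact (tsum_mul_sojournTime_of_mem hs y).le
  have h := tabooPotential_le (P := jumpProb Q) (H := H)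
    (b := fun a => ∑' i, (if i ∈ H then y i else 0) * escapeRate Q H i a)
    -- Inside `H` the bound is `0`: the flow out of `H` is already counted in the source `b`.
    (u := fun s => if s ∈ H then 0 else y s * exitRate Q s) (fun j => ?_) s
  · rw [tabooPotential_add] at h
    simp only [sojournTime, if_neg hs, ← mul_div_assoc] at h ⊢
    simp only [div_eq_mul_inv, ENNReal.tsum_mul_right]
    exact ENNReal.div_le_of_le_mul h
  · by_cases hj : j ∈ H
    · simp [hj, escapeRate]
    · simp only [hj, if_false]
      refine le_of_eq_of_le ?_ (hy j hj)
      rw [← ENNReal.tsum_add]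
      refine tsum_congr fun t => ?_
      by_cases ht : t ∈ H
      · simp [ht, hj, escapeRate]
      · simp [ht, mul_assoc, exitRate_mul_jumpProb hq]

open Classical in
-- The left side is at most `x`, agrees with `x` on `H` and is balanced off `H`, hence
-- superinvariant everywhere. Such measures are proportional, and a common value on `H` fixes the
-- factor.
theorem tsum_mul_sojournTime_eq (hirr : IsIrreducibleGenerator Q) (hq : ∀ i, Q i i < 0)
    (hret : ∀ o, returnProb Q o = 1) (hmean : ∀ o, meanReturnTime Q o < ∞) {H : Set S}
    (hH : H.Nonempty) {x : S → ℝ≥0∞}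
    (hx : ∀ s, ∑' t, x t * jumpRate Q t s = x s * exitRate Q s) (hxt : ∀ s, x s ≠ ∞) (s : S) :
    ∑' i, (if i ∈ H then x i else 0) * sojournTime Q H i s = x s := by
  obtain ⟨o, ho⟩ := hH
  set x' : S → ℝ≥0∞ := fun s => ∑' i, (if i ∈ H then x i else 0) * sojournTime Q H i s with hx'
  have hle : ∀ s, x' s ≤ x s := tsum_mul_sojournTime_le hq fun s _ => (hx s).le
  have heq : ∀ s ∈ H, x' s = x s := fun s hs => tsum_mul_sojournTime_of_mem hs x
  have hsup : ∀ s, ∑' t, x' t * jumpRate Q t s ≤ x' s * exitRate Q s := by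
    intro s
    by_cases hs : s ∈ H
    · rw [heq s hs, ← hx s]
      gcongr with t
      exact hle t
    · simp only [hx', ← ENNReal.tsum_mul_right]
      rw [ENNReal.tsum_comm]
      refine le_of_eq (tsum_congr fun i => ?_)
      simp only [mul_assoc, ENNReal.tsum_mul_left]
      by_cases hi : i ∈ H
      · rw [tsum_sojournTime_mul_jumpRate hq hi hs]
      · simp [hi]
  have h1 := eq_mul_cycleMeasure hirr hq (hret o) (hmean o) hsup (heq o ho ▸ hxt o) s
  have h2 := eq_mul_cycleMeasure hirr hq (hret o) (hmean o) (fun s => (hx s).le) (hxt o) s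
  rw [heq o ho, ← h2] at h1
  exact h1

theorem ENNReal.eq_of_le_of_tsum_eq {ι : Type*} {f g : ι → ℝ≥0∞} (h : ∀ i, f i ≤ g i)
    (hs : ∑' i, f i = ∑' i, g i) (hfin : ∑' i, f i ≠ ∞) (i : ι) : f i = g i := by
  by_contra hne
  exact (ENNReal.tsum_lt_tsum hfin h (lt_of_le_of_ne (h i) hne)).ne hs

theorem sojournTime_ne_top (hq : ∀ i, Q i i < 0) {H : Set S} {x : S → ℝ≥0∞}
    (hx : ∀ s, ∑' t, x t * jumpRate Q t s = x s * exitRate Q s) (hxt : ∀ s, x s ≠ ∞)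
    (hx0 : ∀ s, x s ≠ 0) {i : S} (hi : i ∈ H) (s : S) : sojournTime Q H i s ≠ ∞ := by
  classical
  intro h
  have h1 := (ENNReal.le_tsum i).trans
    (tsum_mul_sojournTime_le hq (H := H) (fun s _ => (hx s).le) s)
  rw [if_pos hi, h, ENNReal.mul_top (hx0 i)] at h1
  exact hxt s (top_le_iff.1 h1)

open Classical in
-- Minimality gives `≤` for each starting state. Weighting by `x` over `H` turns both sides into `x
-- s`, so with positive finite weights every inequality is an equality.
theorem tsum_sojournTime_mul_sojournTime (hirr : IsIrreducibleGenerator Q)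
    (hq : ∀ i, Q i i < 0) (hret : ∀ o, returnProb Q o = 1) (hmean : ∀ o, meanReturnTime Q o < ∞)
    {H H' : Set S} (hH : H ⊆ H') {x : S → ℝ≥0∞}
    (hx : ∀ s, ∑' t, x t * jumpRate Q t s = x s * exitRate Q s) (hxt : ∀ s, x s ≠ ∞)
    (hx0 : ∀ s, x s ≠ 0) {i : S} (hi : i ∈ H) (s : S) :
    ∑' k, (if k ∈ H' then sojournTime Q H i k else 0) * sojournTime Q H' k s =
      sojournTime Q H i s := by
  have hne : H.Nonempty := ⟨i, hi⟩
  have hT : ∀ s, ∑' i, (if i ∈ H then x i else 0) * sojournTime Q H i s = x s :=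
    tsum_mul_sojournTime_eq hirr hq hret hmean hne hx hxt
  have hT' := tsum_mul_sojournTime_eq hirr hq hret hmean (hne.mono hH) hx hxt s
  have hle : ∀ j, (if j ∈ H then x j else 0) *
      ∑' k, (if k ∈ H' then sojournTime Q H j k else 0) * sojournTime Q H' k s ≤
      (if j ∈ H then x j else 0) * sojournTime Q H j s := by
    intro j
    by_cases hj : j ∈ H
    · gcongr
      exact tsum_mul_sojournTime_le hq (fun s hs =>
        (tsum_sojournTime_mul_jumpRate hq hj fun h => hs (hH h)).le) s
    · simp [hj]
  have hsum : ∑' j, (if j ∈ H then x j else 0) *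
      ∑' k, (if k ∈ H' then sojournTime Q H j k else 0) * sojournTime Q H' k s = x s := by
    simp only [← ENNReal.tsum_mul_left]
    rw [ENNReal.tsum_comm, ← hT']
    refine tsum_congr fun k => ?_
    simp only [← mul_assoc, ENNReal.tsum_mul_right]
    by_cases hk : k ∈ H'
    · simp only [hk, if_true, hT]
    · simp [hk]
  have h := ENNReal.eq_of_le_of_tsum_eq hle (hsum.trans (hT s).symm) (hsum ▸ hxt s) i
  rw [if_pos hi] at h
  exact (ENNReal.mul_right_inj (hx0 i) (hxt i)).1 h

theorem sojournTime_eq_zero {H : Set S} {i s : S} (hs : s ∉ H)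
    (h : ∀ a ∉ H, jumpRate Q i a = 0) : sojournTime Q H i s = 0 := by
  have h0 : ∀ a, escapeRate Q H i a = 0 := fun a => by
    by_cases ha : a ∈ H
    · simp [escapeRate, ha]
    · simp [escapeRate, ha, h a ha]
  simp [sojournTime, hs, tabooPotential, h0]

open Classical in
-- Excursions from `E` are regrouped by their last state `k` outside `E` instead of their first
-- state `a`.
theorem tsum_mul_entranceProb (hq : ∀ i, Q i i < 0) {E : Set S} {i : S} (hi : i ∈ E) (j : S) :
    (∑' a, if a ∈ E then 0 else ENNReal.ofReal (Q i a) * entranceProb (jumpProb Q) E a j) =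
      ∑' k, if k ∈ E then 0 else sojournTime Q E i k * jumpRate Q k j := by
  have h1 : ∀ a, (if a ∈ E then 0 else ENNReal.ofReal (Q i a) * entranceProb (jumpProb Q) E a j) =
      ∑' k, escapeRate Q E i a * tabooGreen (jumpProb Q) E a k * jumpProb Q k j := by
    intro a
    by_cases ha : a ∈ E
    · simp [ha, escapeRate]
    · have hia : i ≠ a := fun h => ha (h ▸ hi)
      simp only [ha, if_false, entranceProb_eq_tsum, escapeRate, jumpRate, hia, mul_assoc,
        ENNReal.tsum_mul_left]
  simp only [h1]
  rw [ENNReal.tsum_comm]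
  refine tsum_congr fun k => ?_
  rw [ENNReal.tsum_mul_right, ← tabooPotential]
  by_cases hk : k ∈ E
  · simp [hk, tabooPotential_escapeRate_of_mem]
  · simp [hk, sojournTime, div_exitRate_mul_jumpRate hq]

end Sojourn

/-! ### Existence and uniqueness of the stationary vector. -/

section Stationary

variable {S : Type*} {Q : Matrix S S ℝ}

theorem IsStationaryVector.balanced (hgen : IsGenerator Q) {x : S → ℝ}
    (hx : IsStationaryVector Q x) (s : S) :
    ∑' t, ENNReal.ofReal (x t) * jumpRate Q t s = ENNReal.ofReal (x s) * exitRate Q s :=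
  (hasSum_mul_generator_iff hgen hx.1 s).1 (hx.2.2 s)

theorem IsStationaryVector.pos (hgen : IsGenerator Q) (hirr : IsIrreducibleGenerator Q)
    {x : S → ℝ} (hx : IsStationaryVector Q x) (s : S) : 0 < x s := by
  refine lt_of_le_of_ne (hx.1 s) fun h => ?_
  have h0 := eq_zero_of_superbalanced hirr (z := fun t => ENNReal.ofReal (x t))
    (fun s => (hx.balanced hgen s).le) (o := s) (by simp [← h])
  have h1 : x = fun _ => 0 := funext fun t => le_antisymm (ENNReal.ofReal_eq_zero.1 (h0 t)) (hx.1 t)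
  have h2 := hx.2.1
  rw [h1] at h2
  exact zero_ne_one (hasSum_zero.unique h2)

/-- Nonnegative invariant vectors are multiples of the stationary vector. -/
theorem IsStationaryVector.eq_mul (hgen : IsGenerator Q) (hirr : IsIrreducibleGenerator Q)
    (hq : ∀ i, Q i i < 0) {o : S} (hret : returnProb Q o = 1) (hmean : meanReturnTime Q o < ∞)
    {x y : S → ℝ} (hx : IsStationaryVector Q x) (hy0 : ∀ i, 0 ≤ y i)
    (hy : ∀ j, HasSum (fun i => y i * Q i j) 0) (s : S) : y s = y o / x o * x s := by
  have h1 := congrArg ENNReal.toReal (eq_mul_cycleMeasure hirr hq hret hmean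
    (fun s => (hx.balanced hgen s).le) ENNReal.ofReal_ne_top s)
  have h2 := congrArg ENNReal.toReal (eq_mul_cycleMeasure hirr hq hret hmean
    (fun s => ((hasSum_mul_generator_iff hgen hy0 s).1 (hy s)).le) ENNReal.ofReal_ne_top s)
  simp only [ENNReal.toReal_mul, ENNReal.toReal_ofReal (hx.1 _),
    ENNReal.toReal_ofReal (hy0 _)] at h1 h2
  have h3 := (hx.pos hgen hirr o).ne'
  rw [h1, h2]
  field_simp

theorem IsStationaryVector.unique (hgen : IsGenerator Q) (hirr : IsIrreducibleGenerator Q)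
    (hq : ∀ i, Q i i < 0) {o : S} (hret : returnProb Q o = 1) (hmean : meanReturnTime Q o < ∞)
    {x y : S → ℝ} (hx : IsStationaryVector Q x) (hy : IsStationaryVector Q y) : y = x := by
  have h := hx.eq_mul hgen hirr hq hret hmean hy.1 hy.2.2
  have h1 : HasSum y (y o / x o * 1) := (hx.2.1.mul_left _).congr_fun h
  have h2 := h1.unique hy.2.1
  rw [mul_one] at h2
  funext s
  rw [h s, h2, one_mul]

theorem exists_isStationaryVector (hgen : IsGenerator Q) (hq : ∀ i, Q i i < 0) {o : S}
    (hret : returnProb Q o = 1) (hmean : meanReturnTime Q o < ∞) :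
    ∃ x, IsStationaryVector Q x := by
  set Z := meanReturnTime Q o with hZ
  have hsum : ∑' j, cycleMeasure Q o j = Z := tsum_cycleMeasure o
  have hZ0 : Z ≠ 0 := fun h => cycleMeasure_self_ne_zero (Q := Q) o
    (by simpa using (ENNReal.le_tsum o).trans (hsum.trans h).le)
  have hw : ∑' j, cycleMeasure Q o j / Z = 1 := by
    simp only [div_eq_mul_inv, ENNReal.tsum_mul_right]
    rw [hsum, ENNReal.mul_inv_cancel hZ0 hmean.ne]
  have hfin : ∀ j, cycleMeasure Q o j / Z ≠ ∞ := fun j =>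
    ((ENNReal.le_tsum j).trans_lt (hw ▸ ENNReal.one_lt_top)).ne
  refine ⟨fun j => (cycleMeasure Q o j / Z).toReal, fun _ => ENNReal.toReal_nonneg, ?_, fun j => ?_⟩
  · have := (ENNReal.hasSum_toReal (hw ▸ ENNReal.one_ne_top))
    rwa [← ENNReal.tsum_toReal_eq hfin, hw, ENNReal.toReal_one] at this
  · rw [hasSum_mul_generator_iff hgen (fun _ => ENNReal.toReal_nonneg)]
    simp only [ENNReal.ofReal_toReal (hfin _)]
    simp only [div_eq_mul_inv, mul_right_comm _ Z⁻¹, ENNReal.tsum_mul_right]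
    rw [cycleMeasure_balanced hq hret]

end Stationary

/-! ### Sums over levels and products of the matrices `R_k`. -/

section QBDStates

variable {m₀ m : ℕ}

theorem hasSum_qbdState {M : Type*} [AddCommMonoid M] [TopologicalSpace M]
    (F : Finset ℕ) {f : QBDState m₀ m → M} (hf : ∀ s, s.1 ∉ F → f s = 0) :
    HasSum f (∑ k ∈ F, ∑ i, f ⟨k, i⟩) := by
  rw [Finset.sum_sigma' F (fun _ => Finset.univ) (fun k i => f ⟨k, i⟩)]
  refine hasSum_sum_of_ne_finset_zero fun s hs => hf s fun h => hs ?_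
  simpa using h

/-- The vectors `y` with `y_0 = δ_0` and `y_{k+1} = y_k R_k + δ_{k+1}`. -/
def chainVec (R : RSequence m₀ m) (δ : ∀ k, Fin (levelSize m₀ m k) → ℝ) :
    ∀ k, Fin (levelSize m₀ m k) → ℝ
  | 0 => δ 0
  | k + 1 => chainVec R δ k ᵥ* R k + δ (k + 1)

variable {R : RSequence m₀ m} {δ : ∀ k, Fin (levelSize m₀ m k) → ℝ}

theorem chainVec_nonneg (hR : ∀ l i j, 0 ≤ R l i j) (hδ : ∀ k i, 0 ≤ δ k i) (k : ℕ)
    (i : Fin (levelSize m₀ m k)) : 0 ≤ chainVec R δ k i := by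
  induction k with
  | zero => exact hδ 0 i
  | succ k ih =>
    have h : 0 ≤ ∑ a, chainVec R δ k a * R k a i :=
      Finset.sum_nonneg fun a _ => mul_nonneg (ih a) (hR k a i)
    exact add_nonneg h (hδ (k + 1) i)

theorem chainVec_eq_zero {l : ℕ} (hδ : ∀ k < l, δ k = 0) {k : ℕ} (hk : k < l) :
    chainVec R δ k = 0 := by
  induction k with
  | zero => exact hδ 0 hk
  | succ k ih => rw [chainVec, ih (by omega), hδ _ hk, Matrix.zero_vecMul, add_zero]

theorem chainVec_eq_source {l : ℕ} (hδ : ∀ k < l, δ k = 0) : chainVec R δ l = δ l := by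
  cases l with
  | zero => rfl
  | succ l => rw [chainVec, chainVec_eq_zero hδ (Nat.lt_succ_self l), Matrix.zero_vecMul, zero_add]

theorem chainVec_succ {l k : ℕ} (hδ : ∀ k, l < k → δ k = 0) (hk : l ≤ k) :
    chainVec R δ (k + 1) = chainVec R δ k ᵥ* R k := by
  rw [chainVec, hδ _ (by omega), add_zero]

/-- Indices such as `0 + k` and `k` are not definitionally equal; at successor levels both matrices
are nevertheless `m × m`, so the equation typechecks. -/
theorem RSequence.congr_index (R : RSequence m₀ m) {a b : ℕ} (h : a = b) :
    (R (a + 1) : Matrix (Fin m) (Fin m) ℝ) = R (b + 1) := by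
  subst h; rfl

theorem vecMul_rProd {y : ∀ k, Fin (levelSize m₀ m k) → ℝ} (hy : ∀ k, y (k + 1) = y k ᵥ* R k)
    (k l : ℕ) : (y k ᵥ* rProd R k l : Fin m → ℝ) = y (k + l + 1) := by
  induction l with
  | zero => exact (hy k).symm
  | succ l ih =>
    rw [rProd, ← Matrix.vecMul_vecMul, ih]
    exact (hy (k + l + 1)).symm

theorem vecMul_rProd_zero {y : ∀ k, Fin (levelSize m₀ m k) → ℝ}
    (hy : ∀ k, y (k + 1) = y k ᵥ* R k) (k : ℕ) :
    (y 0 ᵥ* rProd R 0 k : Fin m → ℝ) = y (k + 1) := by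
  induction k with
  | zero => exact (hy 0).symm
  | succ k ih =>
    rw [rProd, ← Matrix.vecMul_vecMul, ih, RSequence.congr_index R (Nat.zero_add k)]
    exact (hy (k + 1)).symm

theorem rProd_nonneg (hR : ∀ l i j, 0 ≤ R l i j) (k l : ℕ) (i : Fin (levelSize m₀ m k))
    (j : Fin m) : 0 ≤ rProd R k l i j := by
  induction l generalizing j with
  | zero => exact hR k i j
  | succ l ih =>
    rw [rProd, Matrix.mul_apply]
    exact Finset.sum_nonneg fun a _ => mul_nonneg (ih a) (hR (k + l + 1) a j)

theorem hasSum_vecMul_rSeries {k : ℕ} (h : Summable (rProd R k))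
    (w : Fin (levelSize m₀ m k) → ℝ) (j : Fin m) :
    HasSum (fun l => (w ᵥ* rProd R k l) j) ((w ᵥ* rSeries R k) j) := by
  have h1 := h.hasSum
  exact hasSum_sum (f := fun i l => w i * rProd R k l i j) (s := Finset.univ) fun i _ =>
    (Pi.hasSum.1 (Pi.hasSum.1 h1 i) j).mul_left (w i)

/-- Each entry of the product, multiplied by `y k i > 0`, is a single term of `y (k + l + 1) j`,
which is summable in `l`. -/
theorem summable_rProd (hR : ∀ l i j, 0 ≤ R l i j) {y : ∀ k, Fin (levelSize m₀ m k) → ℝ}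
    (hy : ∀ k, y (k + 1) = y k ᵥ* R k) (hy0 : ∀ k i, 0 < y k i)
    (hsum : Summable fun s : QBDState m₀ m => y s.1 s.2) (k : ℕ) : Summable (rProd R k) := by
  refine Pi.summable.2 fun i => Pi.summable.2 fun j => ?_
  have h1 : Summable fun l => (y (k + l + 1) : Fin m → ℝ) j :=
    hsum.comp_injective (i := fun l => (⟨k + l + 1, j⟩ : QBDState m₀ m)) fun a b hab => by
      have := congrArg Sigma.fst hab
      simp only at this
      omega
  refine Summable.of_nonneg_of_le (fun l => rProd_nonneg hR k l i j) (fun l => ?_)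
    (h1.mul_left (y k i)⁻¹)
  rw [le_inv_mul_iff₀ (hy0 k i), ← vecMul_rProd hy]
  exact Finset.single_le_sum (f := fun a => y k a * rProd R k l a j)
    (fun a _ => mul_nonneg (hy0 k a).le (rProd_nonneg hR k l a j)) (Finset.mem_univ i)

end QBDStates

/-! ### The equation `yQ = 0` level by level. -/

namespace LevelDependentQBD

variable {m₀ m : ℕ} (A : LevelDependentQBD m₀ m)

theorem Q_same (k : ℕ) (i j : Fin (levelSize m₀ m k)) : A.Q ⟨k, i⟩ ⟨k, j⟩ = A.A1 k i j := by
  simp [Q]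

theorem Q_up (k : ℕ) (i : Fin (levelSize m₀ m k)) (j : Fin (levelSize m₀ m (k + 1))) :
    A.Q ⟨k, i⟩ ⟨k + 1, j⟩ = A.A0 k i j := by
  simp [Q]

theorem Q_down (k : ℕ) (i : Fin (levelSize m₀ m (k + 1))) (j : Fin (levelSize m₀ m k)) :
    A.Q ⟨k + 1, i⟩ ⟨k, j⟩ = A.A2 k i j := by
  simp [Q, show k ≠ k + 1 + 1 by omega]

theorem Q_eq_zero {s t : QBDState m₀ m} (h1 : t.1 ≠ s.1) (h2 : t.1 ≠ s.1 + 1)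
    (h3 : s.1 ≠ t.1 + 1) : A.Q s t = 0 := by
  simp [Q, h1, h2, h3]

theorem jumpRate_eq_zero {s t : QBDState m₀ m} (h1 : t.1 ≠ s.1) (h2 : t.1 ≠ s.1 + 1)
    (h3 : s.1 ≠ t.1 + 1) : jumpRate A.Q s t = 0 := by
  simp [jumpRate, A.Q_eq_zero h1 h2 h3]

theorem hasSum_mul_Q_zero (y : ∀ k, Fin (levelSize m₀ m k) → ℝ) (j : Fin (levelSize m₀ m 0)) :
    HasSum (fun s : QBDState m₀ m => y s.1 s.2 * A.Q s ⟨0, j⟩)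
      ((y 0 ᵥ* A.A1 0 + y 1 ᵥ* A.A2 0) j) := by
  convert hasSum_qbdState {0, 1} (f := fun s : QBDState m₀ m => y s.1 s.2 * A.Q s ⟨0, j⟩)
    (fun s hs => ?_) using 1
  · rw [Finset.sum_insert (by simp), Finset.sum_singleton]
    simp only [Q_same, Q_down]
    rfl
  · simp only [Finset.mem_insert, Finset.mem_singleton, not_or] at hs
    rw [A.Q_eq_zero (by simp; omega) (by simp) (by simp; omega), mul_zero]

theorem hasSum_mul_Q_succ (y : ∀ k, Fin (levelSize m₀ m k) → ℝ) (k : ℕ)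
    (j : Fin (levelSize m₀ m (k + 1))) :
    HasSum (fun s : QBDState m₀ m => y s.1 s.2 * A.Q s ⟨k + 1, j⟩)
      ((y k ᵥ* A.A0 k + y (k + 1) ᵥ* A.A1 (k + 1) + y (k + 2) ᵥ* A.A2 (k + 1)) j) := by
  convert hasSum_qbdState {k, k + 1, k + 2}
    (f := fun s : QBDState m₀ m => y s.1 s.2 * A.Q s ⟨k + 1, j⟩) (fun s hs => ?_) using 1
  · rw [Finset.sum_insert (by simp), Finset.sum_insert (by simp), Finset.sum_singleton, ← add_assoc]
    simp only [Q_same, Q_down, Q_up]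
    rfl
  · simp only [Finset.mem_insert, Finset.mem_singleton, not_or] at hs
    rw [A.Q_eq_zero (by simp; omega) (by simp; omega) (by simp; omega), mul_zero]

variable {A}

theorem IsNonnegSolution.vecMul_eq_zero {R : RSequence m₀ m} (hR : A.IsNonnegSolution R)
    {y : ∀ k, Fin (levelSize m₀ m k) → ℝ} {k : ℕ} (h1 : y (k + 1) = y k ᵥ* R k)
    (h2 : y (k + 2) = y (k + 1) ᵥ* R (k + 1)) :
    y k ᵥ* A.A0 k + y (k + 1) ᵥ* A.A1 (k + 1) + y (k + 2) ᵥ* A.A2 (k + 1) = 0 := by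
  rw [h2, h1, Matrix.vecMul_vecMul, Matrix.vecMul_vecMul, Matrix.vecMul_vecMul,
    ← Matrix.mul_assoc, ← Matrix.vecMul_add,
    ← Matrix.vecMul_add, hR.2 k, Matrix.vecMul_zero]

theorem IsMinimalNonnegSolution.eq {R R' : RSequence m₀ m} (h : A.IsMinimalNonnegSolution R)
    (h' : A.IsMinimalNonnegSolution R') : R = R' := by
  funext l
  ext i j
  exact le_antisymm (h.2 R' h'.1 l i j) (h'.2 R h.1 l i j)

end LevelDependentQBD

/-! ### The probabilistic rate matrices: equation, minimality and censoring. -/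

namespace LevelDependentQBD

variable {m₀ m : ℕ}

/-- The states of the levels up to `l`. -/
def levelsLE (m₀ m l : ℕ) : Set (QBDState m₀ m) := {s | s.1 ≤ l}

theorem mem_levelsLE {l : ℕ} {s : QBDState m₀ m} : s ∈ levelsLE m₀ m l ↔ s.1 ≤ l := Iff.rfl

variable (A : LevelDependentQBD m₀ m)

/-- The expected times spent in level `l + 1` before returning to the levels up to `l`, per unit of
time spent in level `l`. -/
def rateMatrix : RSequence m₀ m := fun l i j =>
  (sojournTime A.Q (levelsLE m₀ m l) ⟨l, i⟩ ⟨l + 1, j⟩).toReal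

theorem rateMatrix_nonneg (l : ℕ) (i : Fin (levelSize m₀ m l)) (j : Fin (levelSize m₀ m (l + 1))) :
    0 ≤ A.rateMatrix l i j := ENNReal.toReal_nonneg

variable {A}

/-- Upward jumps rise by one level, so an excursion above level `l` can only start from level `l`
itself. -/
theorem sojournTime_eq_zero_of_lt {l : ℕ} {s t : QBDState m₀ m} (hs : s.1 < l) (ht : l < t.1) :
    sojournTime A.Q (levelsLE m₀ m l) s t = 0 := by
  refine sojournTime_eq_zero (by simpa [mem_levelsLE] using ht) fun a ha => ?_
  rw [mem_levelsLE, not_le] at ha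
  exact A.jumpRate_eq_zero (by omega) (by omega) (by omega)

open Classical in
/-- Only the last level matters in sums over the levels up to `l`. -/
theorem tsum_levelsLE_mul_sojournTime (y : QBDState m₀ m → ℝ≥0∞) {l : ℕ} {t : QBDState m₀ m}
    (ht : l < t.1) :
    ∑' s, (if s ∈ levelsLE m₀ m l then y s else 0) * sojournTime A.Q (levelsLE m₀ m l) s t =
      ∑ i, y ⟨l, i⟩ * sojournTime A.Q (levelsLE m₀ m l) ⟨l, i⟩ t := by
  rw [(hasSum_qbdState {l} (fun s hs => ?_)).tsum_eq, Finset.sum_singleton]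
  · simp [mem_levelsLE]
  · rw [Finset.mem_singleton] at hs
    rcases lt_or_gt_of_ne hs with h | h
    · rw [sojournTime_eq_zero_of_lt h ht, mul_zero]
    · rw [if_neg (by rw [mem_levelsLE]; omega), zero_mul]

/-- A positive recurrent irreducible QBD process with a stationary vector `x`. -/
structure IsErgodic (A : LevelDependentQBD m₀ m) (x : QBDState m₀ m → ℝ) : Prop where
  size_pos : 0 < m₀
  isGenerator : IsGenerator A.Q
  irreducible : IsIrreducibleGenerator A.Q
  diag_neg : ∀ i, A.Q i i < 0
  return_eq_one : ∀ o, returnProb A.Q o = 1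
  mean_lt_top : ∀ o, meanReturnTime A.Q o < ∞
  stationary : IsStationaryVector A.Q x

namespace IsErgodic

variable {x : QBDState m₀ m → ℝ}

theorem pos (h : IsErgodic A x) (s : QBDState m₀ m) : 0 < x s :=
  h.stationary.pos h.isGenerator h.irreducible s

theorem balanced (h : IsErgodic A x) (s : QBDState m₀ m) :
    ∑' t, ENNReal.ofReal (x t) * jumpRate A.Q t s = ENNReal.ofReal (x s) * exitRate A.Q s :=
  h.stationary.balanced h.isGenerator s

theorem sojournTime_ne_top (h : IsErgodic A x) (l : ℕ) (i : Fin (levelSize m₀ m l))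
    (t : QBDState m₀ m) : sojournTime A.Q (levelsLE m₀ m l) ⟨l, i⟩ t ≠ ∞ :=
  _root_.sojournTime_ne_top h.diag_neg h.balanced (fun _ => ENNReal.ofReal_ne_top)
    (fun s => by simpa using h.pos s) (i := ⟨l, i⟩)
    (mem_levelsLE.2 le_rfl) t

theorem vecMul_rateMatrix (h : IsErgodic A x) (l : ℕ) :
    (fun j => x ⟨l + 1, j⟩) = (fun i => x ⟨l, i⟩) ᵥ* A.rateMatrix l := by
  funext j
  have h1 := tsum_mul_sojournTime_eq h.irreducible h.diag_neg h.return_eq_one h.mean_lt_top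
    (H := levelsLE m₀ m l) ⟨⟨0, ⟨0, h.size_pos⟩⟩, mem_levelsLE.2 l.zero_le⟩ h.balanced
    (fun _ => ENNReal.ofReal_ne_top) ⟨l + 1, j⟩
  rw [tsum_levelsLE_mul_sojournTime _ (Nat.lt_succ_self l)] at h1
  have h2 := congrArg ENNReal.toReal h1
  rw [ENNReal.toReal_ofReal (h.pos _).le, ENNReal.toReal_sum fun i _ =>
    ENNReal.mul_ne_top ENNReal.ofReal_ne_top (h.sojournTime_ne_top l i _)] at h2
  simp only [ENNReal.toReal_mul, ENNReal.toReal_ofReal (h.pos _).le] at h2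
  exact h2.symm

theorem sojournTime_add_two (h : IsErgodic A x) (l : ℕ) (i : Fin (levelSize m₀ m l))
    (j : Fin (levelSize m₀ m (l + 2))) :
    (sojournTime A.Q (levelsLE m₀ m l) ⟨l, i⟩ ⟨l + 2, j⟩).toReal =
      (A.rateMatrix l * A.rateMatrix (l + 1)) i j := by
  have h1 := tsum_sojournTime_mul_sojournTime h.irreducible h.diag_neg h.return_eq_one
    h.mean_lt_top (H := levelsLE m₀ m l) (H' := levelsLE m₀ m (l + 1))
    (fun s hs => mem_levelsLE.2 ((mem_levelsLE.1 hs).trans l.le_succ)) h.balanced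
    (fun _ => ENNReal.ofReal_ne_top) (fun s => by simpa using h.pos s) (i := ⟨l, i⟩)
    (mem_levelsLE.2 le_rfl) ⟨l + 2, j⟩
  rw [tsum_levelsLE_mul_sojournTime _ (Nat.lt_succ_self (l + 1))] at h1
  rw [← h1, ENNReal.toReal_sum fun k _ => ENNReal.mul_ne_top (h.sojournTime_ne_top l i _)
    (h.sojournTime_ne_top (l + 1) k _)]
  simp only [ENNReal.toReal_mul]
  rfl

theorem isNonnegSolution (h : IsErgodic A x) : A.IsNonnegSolution A.rateMatrix := by
  refine ⟨A.rateMatrix_nonneg, fun l => ?_⟩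
  ext i j
  -- On levels `l`, `l + 1`, `l + 2` this vector is the `i`-th row of `I`, `R_l`, `R_l R_{l+1}`; its
  -- balance at level `l + 1` is the `i`-th row of the equation.
  set y : ∀ k, Fin (levelSize m₀ m k) → ℝ := fun k a =>
    (sojournTime A.Q (levelsLE m₀ m l) ⟨l, i⟩ ⟨k, a⟩).toReal with hy
  have hfin : ∀ t, sojournTime A.Q (levelsLE m₀ m l) ⟨l, i⟩ t ≠ ∞ :=
    h.sojournTime_ne_top l i
  have h1 : HasSum (fun s : QBDState m₀ m => y s.1 s.2 * A.Q s ⟨l + 1, j⟩) 0 := by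
    rw [hasSum_mul_generator_iff h.isGenerator (x := fun s : QBDState m₀ m => y s.1 s.2)
      (fun _ => ENNReal.toReal_nonneg)]
    simp only [hy, ENNReal.ofReal_toReal (hfin _)]
    exact tsum_sojournTime_mul_jumpRate h.diag_neg (mem_levelsLE.2 le_rfl)
      (by simp [mem_levelsLE])
  have h2 := (A.hasSum_mul_Q_succ y l j).unique h1
  have hy0 : y l = Pi.single i 1 := by
    funext a
    by_cases ha : i = a
    · subst ha; simp [hy, sojournTime, mem_levelsLE]
    · simp [hy, sojournTime, mem_levelsLE, ha, Ne.symm ha]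
  have hy1 : y (l + 1) = A.rateMatrix l i := rfl
  have hy2 : y (l + 2) = (A.rateMatrix l * A.rateMatrix (l + 1)) i :=
    funext fun a => h.sojournTime_add_two l i a
  rw [hy0, hy1, hy2, Matrix.single_one_vecMul] at h2
  exact h2

theorem rateMatrix_le (h : IsErgodic A x) {R : RSequence m₀ m} (hR : A.IsNonnegSolution R) (l : ℕ)
    (i : Fin (levelSize m₀ m l)) (j : Fin (levelSize m₀ m (l + 1))) :
    A.rateMatrix l i j ≤ R l i j := by
  classical
  -- A unit source at `(l, i)` yields zero below level `l`, then the `i`-th rows of `I`, `R_l`, `R_l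
  -- R_{l+1}`, …. This is balanced above level `l`, so it dominates the least such measure.
  set δ : ∀ k, Fin (levelSize m₀ m k) → ℝ := fun k a =>
    if (⟨k, a⟩ : QBDState m₀ m) = ⟨l, i⟩ then 1 else 0 with hδ
  have hδne : ∀ k, k ≠ l → δ k = 0 := fun k hk => funext fun a =>
    if_neg fun hka => hk (congrArg Sigma.fst hka)
  have hδl : δ l = Pi.single i 1 := by
    funext a
    by_cases ha : a = i
    · subst ha; simp [hδ]
    · simp [hδ, ha]
  set y := chainVec R δ with hy
  have hynn : ∀ k a, 0 ≤ y k a :=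
    chainVec_nonneg hR.1 fun k a => by simp only [hδ]; split_ifs <;> norm_num
  have hyl : y l = Pi.single i 1 := by
    rw [hy, chainVec_eq_source fun k hk => hδne k hk.ne, hδl]
  have hys : ∀ k, l ≤ k → y (k + 1) = y k ᵥ* R k := fun k hk =>
    chainVec_succ (fun k hk => hδne k hk.ne') hk
  have h1 := tsum_mul_sojournTime_le h.diag_neg (H := levelsLE m₀ m l)
    (y := fun s : QBDState m₀ m => ENNReal.ofReal (y s.1 s.2)) ?_ ⟨l + 1, j⟩
  · rw [tsum_levelsLE_mul_sojournTime _ (Nat.lt_succ_self l)] at h1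
    have h2 := (Finset.single_le_sum (fun _ _ => zero_le) (Finset.mem_univ i)).trans h1
    simp only [hyl, hys l le_rfl, Matrix.single_one_vecMul, Pi.single_eq_same, ENNReal.ofReal_one,
      one_mul] at h2
    exact ENNReal.toReal_le_of_le_ofReal (hR.1 l i j) h2
  · rintro ⟨k, a⟩ hk
    rw [mem_levelsLE, not_le] at hk
    obtain _ | k := k
    · exact absurd hk (Nat.not_lt_zero l)
    have hk' : l ≤ k := Nat.le_of_lt_succ hk
    refine ((hasSum_mul_generator_iff h.isGenerator (x := fun s : QBDState m₀ m => y s.1 s.2)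
      (fun s => hynn s.1 s.2) ⟨k + 1, a⟩).1 ?_).le
    have h3 := A.hasSum_mul_Q_succ y k a
    rwa [hR.vecMul_eq_zero (hys k hk') (hys (k + 1) (hk'.trans k.le_succ))] at h3

theorem isMinimalNonnegSolution (h : IsErgodic A x) : A.IsMinimalNonnegSolution A.rateMatrix :=
  ⟨h.isNonnegSolution, fun _ hR => h.rateMatrix_le hR⟩

/-- An excursion from level `0` can return only from level `1`, where `R_0` measures the time spent
and `A_2^{(1)}` gives the rates of return. -/
theorem U0_eq_censoredGenerator (h : IsErgodic A x) (i j : Fin (levelSize m₀ m 0)) :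
    A.U0 A.rateMatrix i j = censoredGenerator A.Q {s | s.1 = 0} ⟨0, i⟩ ⟨0, j⟩ := by
  classical
  have hE : {s : QBDState m₀ m | s.1 = 0} = levelsLE m₀ m 0 := by
    ext s; simp [mem_levelsLE]
  have hrate : ∀ a, jumpRate A.Q ⟨1, a⟩ ⟨0, j⟩ = ENNReal.ofReal (A.A2 0 a j) := fun a => by
    rw [jumpRate, if_neg (by simp), ← A.Q_down]
  have hA2 : ∀ a, 0 ≤ A.A2 0 a j := fun a => by
    rw [← A.Q_down]
    exact h.isGenerator.1 _ _ (by simp)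
  rw [censoredGenerator, hE, tsum_mul_entranceProb h.diag_neg (i := ⟨0, i⟩) (mem_levelsLE.2 le_rfl),
    (hasSum_qbdState {1} (fun s hs => ?_)).tsum_eq, Finset.sum_singleton, Q_same]
  · simp only [mem_levelsLE, show ¬ (1 ≤ 0) by decide, if_false, hrate]
    rw [ENNReal.toReal_sum fun a _ => ENNReal.mul_ne_top (h.sojournTime_ne_top 0 i _)
      ENNReal.ofReal_ne_top]
    simp only [ENNReal.toReal_mul, ENNReal.toReal_ofReal (hA2 _)]
    rfl
  · split_ifs with h0
    · rfl
    · rw [mem_levelsLE] at h0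
      rw [Finset.mem_singleton] at hs
      rw [A.jumpRate_eq_zero (by simp; omega) (by simp) (by simp; omega), mul_zero]

/-- A vector `v` with `v U_0 = 0` extends to the invariant vector `v, v R_0, v R_0 R_1, …`. -/
theorem hasSum_extend_mul_Q (h : IsErgodic A x) {y : ∀ k, Fin (levelSize m₀ m k) → ℝ}
    (hy : ∀ k, y (k + 1) = y k ᵥ* A.rateMatrix k) (h0 : y 0 ᵥ* A.U0 A.rateMatrix = 0)
    (t : QBDState m₀ m) : HasSum (fun s : QBDState m₀ m => y s.1 s.2 * A.Q s t) 0 := by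
  obtain ⟨_ | k, j⟩ := t
  · have h1 := A.hasSum_mul_Q_zero y j
    rwa [hy 0, Matrix.vecMul_vecMul, ← Matrix.vecMul_add, ← U0, h0] at h1
  · have h1 := A.hasSum_mul_Q_succ y k j
    rwa [h.isNonnegSolution.vecMul_eq_zero (hy k) (hy (k + 1))] at h1

theorem vecMul_U0 (h : IsErgodic A x) : (fun i => x ⟨0, i⟩) ᵥ* A.U0 A.rateMatrix = 0 := by
  rw [U0, Matrix.vecMul_add, ← Matrix.vecMul_vecMul, ← h.vecMul_rateMatrix]
  funext j
  exact (A.hasSum_mul_Q_zero (fun k i => x ⟨k, i⟩) j).unique (h.stationary.2.2 ⟨0, j⟩)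

end IsErgodic

end LevelDependentQBD

/-! ### Stationary vector of `U_0`, normalization and tails. -/

namespace LevelDependentQBD

variable {m₀ m : ℕ} {A : LevelDependentQBD m₀ m}

/-- Levels `0` and `1` are both nonempty, so irreducibility excludes the absorbing alternative in
positive recurrence. -/
theorem exists_isErgodic (hm₀ : 0 < m₀) (hm : 0 < m) (hgen : IsGenerator A.Q)
    (hirr : IsIrreducibleGenerator A.Q) (hrec : IsPositiveRecurrent A.Q) :
    ∃ x, IsErgodic A x := by
  have : Nontrivial (QBDState m₀ m) := ⟨⟨0, ⟨0, hm₀⟩⟩, ⟨1, ⟨0, hm⟩⟩, by simp⟩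
  have hq := diag_neg_of_irreducible hgen hirr
  have hr : ∀ o, returnProb A.Q o = 1 ∧ meanReturnTime A.Q o < ∞ := fun o =>
    (hrec o).resolve_left (hq o).ne
  obtain ⟨x, hx⟩ := exists_isStationaryVector hgen hq (o := ⟨0, ⟨0, hm₀⟩⟩) (hr _).1 (hr _).2
  exact ⟨x, hm₀, hgen, hirr, hq, fun o => (hr o).1, fun o => (hr o).2, hx⟩

namespace IsErgodic

variable {x : QBDState m₀ m → ℝ}

theorem eq_of_isStationaryVector (h : IsErgodic A x) {y : QBDState m₀ m → ℝ}
    (hy : IsStationaryVector A.Q y) : y = x :=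
  h.stationary.unique h.isGenerator h.irreducible h.diag_neg
    (o := ⟨0, ⟨0, h.size_pos⟩⟩) (h.return_eq_one _) (h.mean_lt_top _) hy

theorem summable_rProd_rateMatrix (h : IsErgodic A x) (k : ℕ) :
    Summable (rProd A.rateMatrix k) :=
  summable_rProd A.rateMatrix_nonneg (y := fun k i => x ⟨k, i⟩) h.vecMul_rateMatrix
    (fun _ _ => h.pos _) h.stationary.2.1.summable k

theorem stationary_U0_vecMul {R : RSequence m₀ m} {v : Fin (levelSize m₀ m 0) → ℝ}
    (hv : IsStationaryVector (A.U0 R) v) : v ᵥ* A.U0 R = 0 :=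
  funext fun j => (hasSum_fintype fun i => v i * A.U0 R i j).unique (hv.2.2 j)

/-- Proportionality needs only invariance and nonnegativity; summability of `y` is a consequence. -/
theorem exists_eq_mul (h : IsErgodic A x) {y : ∀ k, Fin (levelSize m₀ m k) → ℝ}
    (hy : ∀ k, y (k + 1) = y k ᵥ* A.rateMatrix k)
    (hv : IsStationaryVector (A.U0 A.rateMatrix) (y 0)) :
    ∃ c, ∀ k i, y k i = c * x ⟨k, i⟩ := by
  have hnn : ∀ k i, 0 ≤ y k i := by
    intro k
    induction k with
    | zero => exact hv.1
    | succ k ih =>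
      intro i
      rw [hy k, Matrix.vecMul, dotProduct]
      exact Finset.sum_nonneg fun a _ => mul_nonneg (ih a) (A.rateMatrix_nonneg k a i)
  exact ⟨_, fun k i => h.stationary.eq_mul h.isGenerator h.irreducible h.diag_neg
    (o := ⟨0, ⟨0, h.size_pos⟩⟩) (h.return_eq_one _) (h.mean_lt_top _)
    (y := fun s : QBDState m₀ m => y s.1 s.2) (fun s => hnn s.1 s.2)
    (h.hasSum_extend_mul_Q hy (stationary_U0_vecMul hv)) ⟨k, i⟩⟩

/-- The sequence `v, v R_0, v R_0 R_1, …`. -/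
theorem exists_chain (R : RSequence m₀ m) (v : Fin (levelSize m₀ m 0) → ℝ) :
    ∃ y : ∀ k, Fin (levelSize m₀ m k) → ℝ, y 0 = v ∧ ∀ k, y (k + 1) = y k ᵥ* R k :=
  ⟨fun k => Nat.rec v (fun k y => y ᵥ* R k) k, rfl, fun _ => rfl⟩

theorem existsUnique_stationary_U0 (h : IsErgodic A x) :
    ∃! v, IsStationaryVector (A.U0 A.rateMatrix) v := by
  set Z := ∑ i, x ⟨0, i⟩ with hZ
  have hZ0 : 0 < Z := Finset.sum_pos (fun i _ => h.pos _) ⟨⟨0, h.size_pos⟩, Finset.mem_univ _⟩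
  refine ⟨fun i => x ⟨0, i⟩ / Z, ⟨fun i => div_nonneg (h.pos _).le hZ0.le, ?_, fun j => ?_⟩, ?_⟩
  · convert hasSum_fintype (fun i => x ⟨0, i⟩ / Z) using 1
    rw [← Finset.sum_div, ← hZ, div_self hZ0.ne']
  · have h1 := (hasSum_fintype fun i => x ⟨0, i⟩ * A.U0 A.rateMatrix i j).div_const Z
    rw [show ∑ i, x ⟨0, i⟩ * A.U0 A.rateMatrix i j = 0 from congrFun h.vecMul_U0 j, zero_div] at h1
    exact h1.congr_fun fun i => div_mul_eq_mul_div _ _ _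
  · intro v hv
    obtain ⟨y, rfl, hy⟩ := exists_chain A.rateMatrix v
    obtain ⟨c, hc⟩ := h.exists_eq_mul hy hv
    have h1 : ∑ i, y 0 i = 1 := (hasSum_fintype _).unique hv.2.1
    simp only [hc, ← Finset.mul_sum, ← hZ] at h1
    funext i
    rw [hc, eq_div_iff hZ0.ne', mul_right_comm, h1, one_mul]

/-- With `y = c x`, the total mass of `y` is `c`. Level `0` contributes `1` and the other levels the
series in `kappa`, so `κ = 1 / c`. -/
theorem kappa_mul (h : IsErgodic A x) {y : ∀ k, Fin (levelSize m₀ m k) → ℝ}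
    (hy : ∀ k, y (k + 1) = y k ᵥ* A.rateMatrix k)
    (hv : IsStationaryVector (A.U0 A.rateMatrix) (y 0)) (k : ℕ) (i : Fin (levelSize m₀ m k)) :
    x ⟨k, i⟩ = kappa A.rateMatrix (y 0) * y k i := by
  obtain ⟨c, hc⟩ := h.exists_eq_mul hy hv
  have h0 : ∑ i, y 0 i = 1 := (hasSum_fintype _).unique hv.2.1
  have hc0 : c ≠ 0 := by
    rintro rfl
    simp [hc] at h0
  have h1 : HasSum (fun s : QBDState m₀ m => y s.1 s.2) c := by
    simpa [hc] using h.stationary.2.1.mul_left c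
  obtain ⟨g, hg⟩ : ∃ g : ℕ → ℝ, ∀ k, g k = ∑ i, y k i := ⟨_, fun _ => rfl⟩
  have h2 : HasSum g c := h1.sigma fun k => by
    rw [hg]
    exact hasSum_fintype _
  have h3 : ∀ j, HasSum (fun k => (y (k + 1) : Fin m → ℝ) j)
      ((y 0 ᵥ* rSeries A.rateMatrix 0) j) := fun j => by
    have := hasSum_vecMul_rSeries (h.summable_rProd_rateMatrix 0) (y 0) j
    simpa only [vecMul_rProd_zero hy] using this
  have h5 : HasSum (fun k => g (k + 1)) (∑ j, (y 0 ᵥ* rSeries A.rateMatrix 0) j) := by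
    refine (hasSum_sum fun j (_ : j ∈ Finset.univ) => h3 j).congr_fun fun k => ?_
    exact hg (k + 1)
  have h6 := h2.unique h5.zero_add
  rw [hg, h0] at h6
  rw [kappa, ← h6, hc, one_div, inv_mul_cancel_left₀ hc0]

theorem hasSum_tail (h : IsErgodic A x) {y : ∀ k, Fin (levelSize m₀ m k) → ℝ}
    (hy : ∀ k, y (k + 1) = y k ᵥ* A.rateMatrix k) (k : ℕ) (j : Fin m) :
    HasSum (fun n : ℕ => (y (k + n + 1) : Fin m → ℝ) j)
      (((y 0 ᵥ* rProd A.rateMatrix 0 k) ᵥ*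
        ((1 : Matrix (Fin m) (Fin m) ℝ) + rSeries A.rateMatrix (k + 1))) j) := by
  rw [Matrix.vecMul_add, Matrix.vecMul_one, vecMul_rProd_zero hy]
  -- The identity matrix accounts for the term `n = 0`, which is level `k + 1`; the series starts at
  -- level `k + 2`.
  refine HasSum.zero_add (f := fun n : ℕ => (y (k + n + 1) : Fin m → ℝ) j) ?_
  have h1 := hasSum_vecMul_rSeries (h.summable_rProd_rateMatrix (k + 1)) (y (k + 1)) j
  refine h1.congr_fun fun n => ?_
  rw [vecMul_rProd hy]
  congr! 2
  omega

end IsErgodic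

end LevelDependentQBD

end

theorem mainTheorem3 {m₀ m : ℕ} (hm₀ : 0 < m₀) (hm : 0 < m) (A : LevelDependentQBD m₀ m)
    (hgen : IsGenerator A.Q) (hirr : IsIrreducibleGenerator A.Q)
    (hrec : IsPositiveRecurrent A.Q) :
    (∃! x, IsStationaryVector A.Q x) ∧
    (∃! R, A.IsMinimalNonnegSolution R) ∧
    ∀ R, A.IsMinimalNonnegSolution R →
      (∀ i j, A.U0 R i j = censoredGenerator A.Q {s | s.1 = 0} ⟨0, i⟩ ⟨0, j⟩) ∧
      (∃! v, IsStationaryVector (A.U0 R) v) ∧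
      (∀ k, Summable (rProd R k)) ∧
      ∀ v x, IsStationaryVector (A.U0 R) v → IsStationaryVector A.Q x →
        (∀ i, x ⟨0, i⟩ = kappa R v * v i) ∧
        (∀ (k : ℕ) (j : Fin m), x ⟨k + 1, j⟩ = kappa R v * (v ᵥ* rProd R 0 k) j) ∧
        ∀ (k : ℕ) (j : Fin m),
          HasSum (fun n : ℕ => x ⟨k + n + 1, j⟩)
            (kappa R v *
              ((v ᵥ* rProd R 0 k) ᵥ* ((1 : Matrix (Fin m) (Fin m) ℝ) + rSeries R (k + 1))) j) := by
  obtain ⟨z, h⟩ := A.exists_isErgodic hm₀ hm hgen hirr hrec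
  refine ⟨⟨z, h.stationary, fun y hy => h.eq_of_isStationaryVector hy⟩,
    ⟨A.rateMatrix, h.isMinimalNonnegSolution, fun R hR => hR.eq h.isMinimalNonnegSolution⟩,
    fun R hR => ?_⟩
  obtain rfl := hR.eq h.isMinimalNonnegSolution
  refine ⟨h.U0_eq_censoredGenerator, h.existsUnique_stationary_U0, h.summable_rProd_rateMatrix,
    fun v x hv hx => ?_⟩
  obtain rfl := h.eq_of_isStationaryVector hx
  obtain ⟨y, rfl, hy⟩ := LevelDependentQBD.IsErgodic.exists_chain A.rateMatrix v
  have hxy := h.kappa_mul hy hv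
  refine ⟨hxy 0, fun k j => ?_, fun k j => ?_⟩
  · rw [vecMul_rProd_zero hy]
    exact hxy (k + 1) j
  · exact ((h.hasSum_tail hy k j).mul_left _).congr_fun fun n => hxy (k + n + 1) j
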